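/- Write $\mathbb{R}_{\max}=\mathbb{R}\cup\{-\infty\}$. Let $(X,d)$ be a separable metric space with a basepoint $b\in X$, and consider the kernel $A_{xy}:=-d(x,y)$ on $X$. Let $$A^+_{xy}=\sup\{A_{xx_1}+A_{x_1x_2}+\dots+A_{x_{n-1}y} : n\ge 1,\ x_1,\dots,x_{n-1}\in X\},$$ and let $A^*_{xy}=A^+_{xy}$ for $x\ne y$ and $A^*_{xx}=\max(0,A^+_{xx})$ (so that here $A^*_{xy}=A^+_{xy}=-d(x,y)$). Put $K_{xy}:=A^*_{xy}-A^*_{by}$. The max-plus Martin space $\mathscr{M}_A$ is the closure of $\{K_{\cdot y}: y\in X\}$ in the topology of pointwise convergence. The minimal Martin space $\mathscr{M}^m_A$ is the set of those $w\in\mathscr{M}_A$ for which $H^\flat(w,w)=0$, where $$H^\flat(z,w):=\limsup_{K_{\cdot x}\to z}\ \liminf_{K_{\cdot y}\to w}\ \bigl(A^*_{bx}+A^+_{xy}-A^*_{by}\bigr);$$ here $\limsup_{K_{\cdot x}\to z} f(x):=\inf_{W\ni z}\sup_{K_{\cdot x}\in W}f(x)$, with $W$ ranging over the open neighbourhoods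 of $z$ in $\mathscr{M}_A$, and $\liminf_{K_{\cdot x}\to z} f(x):=\sup_{W\ni z}\inf_{K_{\cdot x}\in W}f(x)$. A max-plus measure on $\mathscr{M}^m_A$ is an upper semicontinuous map $\mu:\mathscr{M}^m_A\to\mathbb{R}_{\max}$, and it represents $u:X\to\mathbb{R}_{\max}$ if $u(x)=\sup_{\xi\in\mathscr{M}^m_A}(\xi(x)+\mu(\xi))$ for all $x\in X$. Lemma. Let $u:X\to\mathbb{R}_{\max}$ be max-plus harmonic for $A$, that is, $u(x)=\sup_{y\in X}(A_{xy}+u(y))$ for all $x\in X$. Then there exists a max-plus measure $\mu$ on $\mathscr{M}^m_A$ that is bounded above, represents $u$, and satisfies $\mu(\xi)\le\nu(\xi)$ for all $\xi\in\mathscr{M}^m_A$ and every max-plus measure $\nu$ on $\mathscr{M}^m_A$ representing $u$. -/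

import Mathlib

open Topology

/-! Max-plus potential theory. The max-plus semiring `ℝ ∪ {-∞}` is modelled inside `EReal`:
`⊔` is max-plus addition, `+` is max-plus multiplication, `⊥` is `-∞`; functions that take values
in `ℝ ∪ {-∞}` are required to avoid `⊤`. -/

namespace MaxPlus

variable {S : Type*}

/-- Weight `A_{i i₁} + ⋯ + A_{i_{n-1} j}` of the path from `i` to `j` (of length `n ≥ 1`)
whose list of intermediate states is `[i₁, …, i_{n-1}]`. -/
noncomputable def pathWeight (A : S → S → EReal) : S → List S → S → EReal
  | i, [], j => A i j
  | i, k :: l, j => A i k + pathWeight A k l j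

/-- The kernel `A⁺`: maximal weight of a path of length at least one. -/
noncomputable def greenPlus (A : S → S → EReal) (i j : S) : EReal :=
  ⨆ l : List S, pathWeight A i l j

/-- The Green kernel `A*`: maximal weight of a path of any length; the path of length zero,
which exists only when `i = j`, has weight `0`. -/
noncomputable def greenStar (A : S → S → EReal) (i j : S) : EReal :=
  (⨆ _ : i = j, (0 : EReal)) ⊔ greenPlus A i j

/-- The column `K_{· j} = A*_{· j} - A*_{b j}` of the Martin kernel with basepoint `b`. -/
noncomputable def martinKernel (A : S → S → EReal) (b j : S) : S → EReal :=
  fun i => greenStar A i j - greenStar A b j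

/-- The max-plus Martin space: closure of the columns of the Martin kernel for the product
topology. -/
def martinSpace (A : S → S → EReal) (b : S) : Set (S → EReal) :=
  closure (Set.range (martinKernel A b))

/-- The filter on states describing `K_{· j} → w`; a basis consists of the sets
`{j | K_{· j} ∈ W}`, with `W` a neighbourhood of `w`. -/
noncomputable def martinFilter (A : S → S → EReal) (b : S) (w : S → EReal) : Filter S :=
  Filter.comap (martinKernel A b) (𝓝 w)

/-- `H♭(z, w)`, the limsup as `K_{· i} → z` of the liminf as `K_{· j} → w` of
`A*_{b i} + A⁺_{i j} - A*_{b j}`. -/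
noncomputable def Hflat (A : S → S → EReal) (b : S) (z w : S → EReal) : EReal :=
  Filter.limsup
    (fun i => Filter.liminf
      (fun j => greenStar A b i + greenPlus A i j - greenStar A b j)
      (martinFilter A b w))
    (martinFilter A b z)

/-- The max-plus minimal Martin space. -/
def minimalMartinSpace (A : S → S → EReal) (b : S) : Set (S → EReal) :=
  {w | w ∈ martinSpace A b ∧ Hflat A b w w = 0}

/-- A max-plus harmonic function `u : S → ℝ ∪ {-∞}` for the kernel `A`. -/
def IsHarmonic (A : S → S → EReal) (u : S → EReal) : Prop :=
  (∀ i, u i ≠ ⊤) ∧ ∀ i, u i = ⨆ j, A i j + u j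

/-- A max-plus measure on a set `D` of functions, identified with its density: an upper
semicontinuous map `D → ℝ ∪ {-∞}`, where `D` has the topology of pointwise convergence. -/
def IsMeasure {D : Set (S → EReal)} (μ : D → EReal) : Prop :=
  (∀ ξ, μ ξ ≠ ⊤) ∧ UpperSemicontinuous μ

/-- `μ` represents `u`: `u = sup_{ξ ∈ D} (ξ + μ(ξ))`. -/
def Represents {D : Set (S → EReal)} (μ : D → EReal) (u : S → EReal) : Prop :=
  ∀ i, u i = ⨆ ξ : D, ξ.1 i + μ ξ

/-- The kernel `A_{xy} = -d(x, y)` of a metric space. -/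
noncomputable def metricKernel (X : Type*) [MetricSpace X] (x y : X) : EReal :=
  ((-dist x y : ℝ) : EReal)

end MaxPlus

/-! The candidate for `μ` is the pointwise infimum of all representing measures, cut down by `ρ ξ =
inf_x (v x - ξ x)`. Infima preserve upper semicontinuity, so the point is that the infimum still
represents `v`. For this, each `x₀` and `ε` need a single point `ξ` and constant `c`, with `ξ + c ≤
v` and nearly equal at `x₀`, such that every representing `ν` has `ν ξ ≥ c`. Such a `ξ` comes from
an almost geodesic from `x₀` along which `v` grows at almost unit speed, each point nearly
maximizing `weightedSum` among admissible successors. The maximization is rigid: any choice of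
admissible successors has the same limit (`tendsto_of_maximizing`). A representing `ν` charges some
`η k` nearly attaining `v (x k)`, and minimality of `η k` turns it into an admissible successor.
Hence `η k → ξ`, and semicontinuity of `ν` gives the bound. -/

namespace MaxPlus

/-! ### Martin space and harmonic functions of a metric space -/

section MetricKernel

variable {X : Type*} [MetricSpace X]

theorem pathWeight_metricKernel_le (l : List X) (i j : X) :
    pathWeight (metricKernel X) i l j ≤ metricKernel X i j := by
  induction l generalizing i with
  | nil => exact le_rfl
  | cons k l ih =>
    calc pathWeight (metricKernel X) i (k :: l) j
        ≤ metricKernel X i k + metricKernel X k j := add_le_add le_rfl (ih k)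
      _ ≤ metricKernel X i j := by
        unfold metricKernel
        have := dist_triangle i k j
        exact_mod_cast (by linarith : -dist i k + -dist k j ≤ -dist i j)

theorem greenPlus_metricKernel (i j : X) :
    greenPlus (metricKernel X) i j = ((-dist i j : ℝ) : EReal) :=
  le_antisymm (iSup_le fun l => pathWeight_metricKernel_le l i j)
    (le_iSup (fun l => pathWeight (metricKernel X) i l j) [])

theorem greenStar_metricKernel (i j : X) :
    greenStar (metricKernel X) i j = ((-dist i j : ℝ) : EReal) := by
  rw [greenStar, greenPlus_metricKernel]
  by_cases h : i = j
  · subst h; simp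
  · simp [h]

theorem martinKernel_metricKernel (b j i : X) :
    martinKernel (metricKernel X) b j i = ((dist b j - dist i j : ℝ) : EReal) := by
  rw [martinKernel, greenStar_metricKernel, greenStar_metricKernel, ← EReal.coe_sub]
  congr 1; ring

/-- Elements of the Martin space of a metric space are real-valued, nonexpansive and vanish at
the basepoint. -/
theorem exists_real_of_mem_martinSpace {b : X} {w : X → EReal}
    (hw : w ∈ martinSpace (metricKernel X) b) :
    ∃ g : X → ℝ, (∀ x, w x = (g x : EReal)) ∧ g b = 0 ∧ ∀ x y, g x ≤ g y + dist x y := by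
  have hadd (y : X) (c : ℝ) : Continuous fun w : X → EReal => w y + (c : EReal) := by
    rw [continuous_iff_continuousAt]
    intro w
    exact (EReal.continuousAt_add (Or.inr (EReal.coe_ne_bot c))
      (Or.inr (EReal.coe_ne_top c))).comp
      (f := fun w : X → EReal => (w y, (c : EReal)))
      ((continuous_apply y).continuousAt.prodMk continuousAt_const)
  -- Both conditions are closed and hold for the columns. Together they exclude `⊤` and `⊥`, by
  -- comparison with the value `0` at `b`.
  let T : Set (X → EReal) := {w | w b = 0} ∩
    ⋂ x, ⋂ y, {w | w x ≤ w y + ((dist x y : ℝ) : EReal)}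
  have hT : IsClosed T := by
    refine (isClosed_eq (continuous_apply b) continuous_const).inter ?_
    exact isClosed_iInter fun x => isClosed_iInter fun y =>
      isClosed_le (continuous_apply x) (hadd y _)
  have hsub : Set.range (martinKernel (metricKernel X) b) ⊆ T := by
    rintro _ ⟨j, rfl⟩
    refine ⟨by simp [martinKernel_metricKernel], ?_⟩
    simp only [Set.mem_iInter, Set.mem_ofPred_eq, martinKernel_metricKernel]
    intro x y
    have := dist_triangle y x j
    rw [dist_comm y x] at this
    exact_mod_cast (by linarith : dist b j - dist x j ≤ dist b j - dist y j + dist x y)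
  obtain ⟨hb, hl⟩ := closure_minimal hsub hT hw
  simp only [Set.mem_iInter, Set.mem_ofPred_eq] at hl hb
  have hreal (x : X) : w x = ((w x).toReal : EReal) := by
    refine (EReal.coe_toReal ?_ ?_).symm
    · intro h
      have := hl x b
      rw [h, hb, zero_add, top_le_iff] at this
      exact EReal.coe_ne_top _ this
    · intro h
      have := hl b x
      rw [h, hb, EReal.bot_add, le_bot_iff] at this
      exact EReal.zero_ne_bot this
  refine ⟨fun x => (w x).toReal, hreal, by simp [hb], fun x y => ?_⟩
  have := hl x y
  rw [hreal x, hreal y] at this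
  exact_mod_cast this

theorem martinFilter_neBot {S : Type*} {A : S → S → EReal} {b : S} {w : S → EReal}
    (hw : w ∈ martinSpace A b) : (martinFilter A b w).NeBot :=
  Filter.comap_neBot fun t ht => by
    obtain ⟨_, hs, j, rfl⟩ := mem_closure_iff_nhds.1 hw t ht
    exact ⟨j, hs⟩

/-- On the Martin space of a metric space, `H♭(z, w)` is the limsup of `w(x) - d(b, x)` as
`K_{· x} → z`. -/
theorem Hflat_metricKernel {b : X} {g : X → ℝ}
    (hw : (fun x => (g x : EReal)) ∈ martinSpace (metricKernel X) b) (z : X → EReal) :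
    Hflat (metricKernel X) b z (fun x => (g x : EReal)) =
      Filter.limsup (fun x => ((g x - dist b x : ℝ) : EReal))
        (martinFilter (metricKernel X) b z) := by
  have := martinFilter_neBot hw
  unfold Hflat
  congr 1
  funext i
  refine Filter.Tendsto.liminf_eq ?_
  have h : Filter.Tendsto (fun j => martinKernel (metricKernel X) b j i)
      (martinFilter (metricKernel X) b fun x => (g x : EReal)) (𝓝 (g i : EReal)) :=
    ((continuous_apply i).tendsto (fun x => (g x : EReal))).comp Filter.tendsto_comap
  simp only [martinKernel_metricKernel] at h
  simp only [greenStar_metricKernel, greenPlus_metricKernel, ← EReal.coe_sub, ← EReal.coe_add]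
  rw [EReal.tendsto_coe] at h ⊢
  convert h.sub_const (dist b i) using 2
  ring

/-- Since `g b = 0` and `g` is nonexpansive, `g ≤ d(b, ·)`. The limsup is therefore never positive,
and only the lower bound is a condition. -/
theorem mem_minimalMartinSpace_iff {b : X} {g : X → ℝ}
    (hw : (fun x => (g x : EReal)) ∈ martinSpace (metricKernel X) b) :
    (fun x => (g x : EReal)) ∈ minimalMartinSpace (metricKernel X) b ↔
      ∀ δ > 0, ∃ᶠ x in martinFilter (metricKernel X) b fun x => (g x : EReal),
        -δ < g x - dist b x := by
  have hne := martinFilter_neBot hw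
  obtain ⟨g', hg', hb, hl⟩ := exists_real_of_mem_martinSpace hw
  obtain rfl : g = g' := funext fun x => EReal.coe_injective (hg' x)
  have hle : Filter.limsup (fun x => ((g x - dist b x : ℝ) : EReal))
      (martinFilter (metricKernel X) b fun x => (g x : EReal)) ≤ 0 := by
    refine Filter.limsup_le_of_le (h := Filter.Eventually.of_forall fun x => ?_)
    have := hl x b
    rw [hb, dist_comm] at this
    exact_mod_cast (by linarith : g x - dist b x ≤ 0)
  rw [minimalMartinSpace, Set.mem_ofPred_eq, Hflat_metricKernel hw, and_iff_right hw]
  constructor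
  · intro h δ hδ
    have : ((-δ : ℝ) : EReal) < Filter.limsup (fun x => ((g x - dist b x : ℝ) : EReal))
        (martinFilter (metricKernel X) b fun x => (g x : EReal)) := by
      rw [h]; exact_mod_cast neg_lt_zero.2 hδ
    exact (Filter.frequently_lt_of_lt_limsup (by isBoundedDefault) this).mono
      fun x hx => EReal.coe_lt_coe_iff.1 hx
  · intro h
    refine le_antisymm hle (le_of_forall_lt fun a ha => ?_)
    obtain ⟨r, har, hr⟩ := EReal.lt_iff_exists_real_btwn.1 ha
    refine har.trans_le (Filter.le_limsup_of_frequently_le ?_)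
    have hr' : r < 0 := by exact_mod_cast hr
    refine (h (-r) (by linarith)).mono fun x hx => ?_
    rw [neg_neg] at hx
    exact_mod_cast hx.le

/-- A harmonic function of a metric space is identically `-∞` or real-valued and nonexpansive. -/
theorem IsHarmonic.eq_bot_or_real {u : X → EReal} (hu : IsHarmonic (metricKernel X) u) :
    (∀ x, u x = ⊥) ∨
      ∃ v : X → ℝ, (∀ x, u x = (v x : EReal)) ∧ ∀ x y, v x ≤ v y + dist x y := by
  have hl (x y : X) : ((-dist x y : ℝ) : EReal) + u y ≤ u x := by
    rw [hu.2 x]; exact le_iSup (fun j => metricKernel X x j + u j) y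
  by_cases h : ∀ x, u x = ⊥
  · exact Or.inl h
  right
  push Not at h
  obtain ⟨y, hy⟩ := h
  have hreal (x : X) : u x = ((u x).toReal : EReal) := by
    refine (EReal.coe_toReal (hu.1 x) fun hx => ?_).symm
    have := hl x y
    rw [hx, le_bot_iff, EReal.add_eq_bot_iff] at this
    exact this.elim (EReal.coe_ne_bot _) hy
  refine ⟨fun x => (u x).toReal, hreal, fun x y => ?_⟩
  have := hl y x
  rw [hreal x, hreal y, dist_comm] at this
  have : -dist x y + (u x).toReal ≤ (u y).toReal := by exact_mod_cast this
  linarith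

end MetricKernel

end MaxPlus

namespace MaxPlus

/-! ### Maximizing almost geodesics -/

section AlmostGeodesic

variable {X : Type*} [MetricSpace X]

open Filter

/-- The weighted sum over a sequence `q` of the values of `v(y) - d(·, y)`. -/
noncomputable def weightedSum (b : X) (q : ℕ → X) (v : X → ℝ) (y : X) : ℝ :=
  ∑' n, (1 / 2 : ℝ) ^ n / (1 + dist b (q n)) * (v y - dist (q n) y)

/-- The denominators in the weights absorb linear growth in `d(b, ·)`, leaving a geometric series.
-/
theorem summable_weight_mul (b : X) (q : ℕ → X) {f : X → ℝ} {C : ℝ}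
    (hf : ∀ x, |f x| ≤ C * (1 + dist b x)) :
    Summable fun n => (1 / 2 : ℝ) ^ n / (1 + dist b (q n)) * f (q n) := by
  refine Summable.of_norm_bounded (g := fun n => C * (1 / 2 : ℝ) ^ n)
    (summable_geometric_two.mul_left C) fun n => ?_
  have hd : 0 < 1 + dist b (q n) := by positivity
  rw [Real.norm_eq_abs, abs_mul, abs_of_pos (by positivity), div_mul_eq_mul_div,
    div_le_iff₀ hd]
  calc (1 / 2 : ℝ) ^ n * |f (q n)| ≤ (1 / 2 : ℝ) ^ n * (C * (1 + dist b (q n))) :=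
        mul_le_mul_of_nonneg_left (hf _) (by positivity)
    _ = _ := by ring

theorem abs_le_of_nonexpansive {f : X → ℝ} (hf : ∀ x y, f x ≤ f y + dist x y) (b x : X) :
    |f x| ≤ (1 + |f b|) * (1 + dist b x) := by
  have h1 := hf x b
  have h2 := hf b x
  rw [dist_comm x b] at h1
  have h3 := le_abs_self (f b)
  have h4 := neg_abs_le (f b)
  have h5 := mul_nonneg (abs_nonneg (f b)) (dist_nonneg (x := b) (y := x))
  rw [abs_le]
  constructor <;> nlinarith

theorem sub_dist_le_sub_dist_add (c : ℝ) (y x z : X) :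
    c - dist x y ≤ c - dist z y + dist x z := by
  have := dist_triangle z x y
  rw [dist_comm z x] at this
  linarith

theorem summable_weightedSum (b : X) (q : ℕ → X) (v : X → ℝ) (y : X) :
    Summable fun n => (1 / 2 : ℝ) ^ n / (1 + dist b (q n)) * (v y - dist (q n) y) :=
  summable_weight_mul b q (f := fun x => v y - dist x y)
    (abs_le_of_nonexpansive (sub_dist_le_sub_dist_add (v y) y) b)

theorem bddAbove_weightedSum (b : X) (q : ℕ → X) {v : X → ℝ}
    (hv : ∀ x y, v x ≤ v y + dist x y) : ∃ B, ∀ y, weightedSum b q v y ≤ B := by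
  refine ⟨∑' n, (1 / 2 : ℝ) ^ n / (1 + dist b (q n)) * v (q n), fun y => ?_⟩
  refine (summable_weightedSum b q v y).tsum_le_tsum (fun n => ?_)
    (summable_weight_mul b q (abs_le_of_nonexpansive hv b))
  refine mul_le_mul_of_nonneg_left ?_ (by positivity)
  have := hv y (q n)
  rw [dist_comm] at this
  linarith

/-- If `v(y) - d(·, y)` dominates `v(x) - d(·, x)` up to `s`, its excess at `q n` is controlled by
the excess of the weighted sums. -/
theorem weight_mul_le_weightedSum_sub (b : X) (q : ℕ → X) (v : X → ℝ) {x y : X} {s : ℝ}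
    (hs : v x - s ≤ v y - dist x y) (n : ℕ) :
    (1 / 2 : ℝ) ^ n / (1 + dist b (q n)) * ((v y - dist (q n) y) - (v x - dist (q n) x) + s) ≤
      weightedSum b q v y - weightedSum b q v x +
        (∑' n, (1 / 2 : ℝ) ^ n / (1 + dist b (q n))) * s := by
  have hw : Summable fun n => (1 / 2 : ℝ) ^ n / (1 + dist b (q n)) := by
    simpa using summable_weight_mul b q (f := fun _ => 1) (C := 1)
      (fun x => by simp [dist_nonneg])
  have h1 := ((summable_weightedSum b q v y).sub (summable_weightedSum b q v x)).add
    (hw.mul_right s)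
  -- After the shift by `s` every term is nonnegative, by the triangle inequality, so one term is at
  -- most the whole sum.
  have h2 := h1.le_tsum n fun m _ => by
    have := dist_triangle (q m) x y
    have hm : 0 ≤ (1 / 2 : ℝ) ^ m / (1 + dist b (q m)) := by positivity
    rw [← mul_sub, ← mul_add]
    exact mul_nonneg hm (by linarith)
  rw [((summable_weightedSum b q v y).sub (summable_weightedSum b q v x)).tsum_add
    (hw.mul_right s), (summable_weightedSum b q v y).tsum_sub (summable_weightedSum b q v x),
    tsum_mul_right] at h2
  refine le_trans (le_of_eq ?_) h2
  ring

/-- From every point starts a sequence along which the nonexpansive function `v` grows at almost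
unit speed, and each of whose points almost maximizes the weighted sum among the admissible
successors of its predecessor. -/
theorem exists_maximizing_almostGeodesic (b : X) (q : ℕ → X) {v : X → ℝ}
    (hv : ∀ x y, v x ≤ v y + dist x y) (x₀ : X) {e : ℕ → ℝ} (he : ∀ k, 0 < e k) :
    ∃ x : ℕ → X, x 0 = x₀ ∧ ∀ k, v (x k) - e k ≤ v (x (k + 1)) - dist (x k) (x (k + 1)) ∧
      ∀ y, v (x k) - e k ≤ v y - dist (x k) y →
        weightedSum b q v y ≤ weightedSum b q v (x (k + 1)) + e k := by
  obtain ⟨B, hB⟩ := bddAbove_weightedSum b q hv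
  have step (k : ℕ) (x : X) : ∃ x', v x - e k ≤ v x' - dist x x' ∧
      ∀ y, v x - e k ≤ v y - dist x y → weightedSum b q v y ≤ weightedSum b q v x' + e k := by
    let T := weightedSum b q v '' {y | v x - e k ≤ v y - dist x y}
    have hne : T.Nonempty := ⟨_, x, by simp [(he k).le], rfl⟩
    have hbdd : BddAbove T := ⟨B, by rintro _ ⟨y, -, rfl⟩; exact hB y⟩
    obtain ⟨_, ⟨x', hx', rfl⟩, hlt⟩ := exists_lt_of_lt_csSup hne (sub_lt_self (sSup T) (he k))
    refine ⟨x', hx', fun y hy => ?_⟩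
    have := le_csSup hbdd ⟨y, hy, rfl⟩
    linarith
  choose next hnext using step
  exact ⟨fun k => Nat.rec x₀ next k, rfl, fun k => hnext k _⟩

/-- A sequence that decreases by at most `e k - e (k + 1)` at step `k`, with `e → 0`, and is
bounded above converges to a limit that is at least its `k`-th term minus `e k`. -/
theorem exists_tendsto_of_almost_monotone {a e : ℕ → ℝ} (he : Tendsto e atTop (𝓝 0))
    (ha : ∀ k, a k - (e k - e (k + 1)) ≤ a (k + 1)) {B : ℝ} (hB : ∀ k, a k ≤ B) :
    ∃ l, Tendsto a atTop (𝓝 l) ∧ ∀ k, a k - e k ≤ l := by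
  have hm : Monotone fun k => a k - e k := monotone_nat_of_le_succ fun k => by
    have := ha k
    linarith
  obtain ⟨c, hc⟩ := he.bddBelow_range
  have hbdd : BddAbove (Set.range fun k => a k - e k) := ⟨B - c, by
    rintro _ ⟨k, rfl⟩
    have := hB k
    have : c ≤ e k := hc ⟨k, rfl⟩
    dsimp only
    linarith⟩
  refine ⟨⨆ k, (a k - e k), ?_, fun k => le_ciSup hbdd k⟩
  simpa using (tendsto_atTop_ciSup hm hbdd).add he

/-- Pointwise convergence of nonexpansive functions follows from convergence on a dense set. -/
theorem tendsto_of_nonexpansive_of_dense {q : ℕ → X} (hq : DenseRange q) {f : ℕ → X → ℝ}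
    {g : X → ℝ} (hf : ∀ k x y, f k x ≤ f k y + dist x y) (hg : ∀ x y, g x ≤ g y + dist x y)
    (h : ∀ n, Tendsto (fun k => f k (q n)) atTop (𝓝 (g (q n)))) (x : X) :
    Tendsto (fun k => f k x) atTop (𝓝 (g x)) := by
  rw [Metric.tendsto_atTop]
  intro ε hε
  obtain ⟨n, hn⟩ := hq.exists_dist_lt x (ε := ε / 3) (by linarith)
  obtain ⟨N, hN⟩ := Metric.tendsto_atTop.1 (h n) (ε / 3) (by linarith)
  refine ⟨N, fun k hk => ?_⟩
  have h1 := hN k hk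
  rw [Real.dist_eq, abs_lt] at h1 ⊢
  have h2 := hf k x (q n)
  have h3 := hf k (q n) x
  have h4 := hg x (q n)
  have h5 := hg (q n) x
  rw [dist_comm (q n)] at h3 h5
  constructor <;> linarith [h1.1, h1.2]

/-- The functions `v(y k) - d(·, y k)` have the same limit as `v(x k) - d(·, x k)` for every
sequence `y` of admissible successors of a maximizing almost geodesic `x`. -/
theorem tendsto_of_maximizing {b : X} {q : ℕ → X} {v : X → ℝ}
    (hv : ∀ x y, v x ≤ v y + dist x y) {e : ℕ → ℝ} (he : Tendsto e atTop (𝓝 0))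
    {x y : ℕ → X} (hx : ∀ k, v (x k) - (e k - e (k + 1)) ≤ v (x (k + 1)) - dist (x k) (x (k + 1)))
    (hmax : ∀ k z, v (x k) - (e k - e (k + 1)) ≤ v z - dist (x k) z →
      weightedSum b q v z ≤ weightedSum b q v (x (k + 1)) + (e k - e (k + 1)))
    (hy : ∀ k, v (x k) - (e k - e (k + 1)) ≤ v (y k) - dist (x k) (y k)) {F : X → ℝ}
    (hF : ∀ z, Tendsto (fun k => v (x k) - dist z (x k)) atTop (𝓝 (F z))) (n : ℕ) :
    Tendsto (fun k => v (y k) - dist (q n) (y k)) atTop (𝓝 (F (q n))) := by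
  set W := ∑' n, (1 / 2 : ℝ) ^ n / (1 + dist b (q n)) with hW
  set w := (1 / 2 : ℝ) ^ n / (1 + dist b (q n)) with hw
  have hwpos : 0 < w := by positivity
  have he' : Tendsto (fun k => e k - e (k + 1)) atTop (𝓝 0) := by
    simpa using he.sub (he.comp (tendsto_add_atTop_nat 1))
  obtain ⟨B, hB⟩ := bddAbove_weightedSum b q hv
  have hstep (k : ℕ) {z : X} (hz : v (x k) - (e k - e (k + 1)) ≤ v z - dist (x k) z) :=
    weight_mul_le_weightedSum_sub b q v hz n
  -- The weighted sums along `x` converge, so their increments vanish. By maximality the gain from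
  -- `x k` to `y k` exceeds the increment by at most `e k - e (k + 1)`, which forces the excess at
  -- each `q n` to vanish too.
  obtain ⟨l, hl, -⟩ := exists_tendsto_of_almost_monotone (a := fun k => weightedSum b q v (x k))
    (e := fun k => W * e k) (by simpa using he.const_mul W) (fun k => by
      have h1 := hstep k (hx k)
      have h2 := dist_triangle (q n) (x k) (x (k + 1))
      have h3 : 0 ≤ w * ((v (x (k + 1)) - dist (q n) (x (k + 1))) - (v (x k) - dist (q n) (x k))
        + (e k - e (k + 1))) := mul_nonneg hwpos.le (by linarith [hx k])
      rw [← hW, ← hw] at h1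
      linarith) (fun k => hB (x k))
  have hl' : Tendsto (fun k => weightedSum b q v (x (k + 1)) - weightedSum b q v (x k)) atTop
      (𝓝 0) := by
    simpa using (hl.comp (tendsto_add_atTop_nat 1)).sub hl
  have hup : Tendsto (fun k => (v (x k) - dist (q n) (x k)) - (e k - e (k + 1)) +
      (weightedSum b q v (x (k + 1)) - weightedSum b q v (x k) + (e k - e (k + 1)) +
        W * (e k - e (k + 1))) / w) atTop (𝓝 (F (q n))) := by
    simpa using ((hF (q n)).sub he').add (((hl'.add he').add (he'.const_mul W)).div_const w)
  have hlow : Tendsto (fun k => (v (x k) - dist (q n) (x k)) - (e k - e (k + 1))) atTop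
      (𝓝 (F (q n))) := by simpa using (hF (q n)).sub he'
  refine tendsto_of_tendsto_of_tendsto_of_le_of_le hlow hup (fun k => ?_) fun k => ?_
  · have := dist_triangle (q n) (x k) (y k)
    have := hy k
    dsimp only
    linarith
  · have h1 := hstep k (hy k)
    have h2 := hmax k _ (hy k)
    rw [← hW, ← hw, mul_comm, ← le_div_iff₀ hwpos] at h1
    have h3 : (weightedSum b q v (y k) - weightedSum b q v (x k) + W * (e k - e (k + 1))) / w ≤
        (weightedSum b q v (x (k + 1)) - weightedSum b q v (x k) + (e k - e (k + 1)) +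
        W * (e k - e (k + 1))) / w := by
      gcongr
      linarith
    dsimp only
    linarith

end AlmostGeodesic

end MaxPlus

namespace MaxPlus

/-! ### Points charged by every representing measure -/

section Representation

variable {X : Type*} [MetricSpace X]

open Filter

/-- If `g + t ≤ v`, with `g` in the minimal Martin space, is almost an equality at `x`, then there
are points `y` with `K_{· y}` close to `g` for which `v(y) - d(·, y)` is almost `v(x)` at `x`. -/
theorem exists_dist_close {b : X} {g : X → ℝ}
    (hg : (fun x => (g x : EReal)) ∈ minimalMartinSpace (metricKernel X) b) {v : X → ℝ} {t : ℝ}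
    (hle : ∀ z, g z + t ≤ v z) {x : X} {δ : ℝ} (hx : v x - δ < g x + t) (hδ : 0 < δ)
    (s : Finset X) :
    ∃ y, v x - 3 * δ ≤ v y - dist x y ∧ ∀ z ∈ s, |dist b y - dist z y - g z| < δ := by
  have hev (z : X) : ∀ᶠ y in martinFilter (metricKernel X) b fun x => (g x : EReal),
      |dist b y - dist z y - g z| < δ := by
    have h : Tendsto (fun j => martinKernel (metricKernel X) b j z)
        (martinFilter (metricKernel X) b fun x => (g x : EReal)) (𝓝 (g z : EReal)) :=
      ((continuous_apply z).tendsto (fun x => (g x : EReal))).comp tendsto_comap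
    simp only [martinKernel_metricKernel, EReal.tendsto_coe] at h
    exact Metric.tendsto_nhds.1 h δ hδ
  -- Minimality gives `g y > d(b, y) - δ`, and closeness at `x` gives `d(b, y) - d(x, y) > g x - δ`.
  -- With `g + t ≤ v` and `hx`, the total loss is below `3 * δ`.
  obtain ⟨y, hy, hyx, hys⟩ := (((mem_minimalMartinSpace_iff hg.1).1 hg δ hδ).and_eventually
    ((hev x).and ((eventually_all_finset s).2 fun z _ => hev z))).exists
  refine ⟨y, ?_, hys⟩
  have := hle y
  rw [abs_lt] at hyx
  linarith [hyx.1]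

/-- If `η + ν(η) ≤ v` fails to be an equality at `x` by less than `δ`, then `ν(η)` is real. -/
theorem Represents.exists_real {b : X} {ν : minimalMartinSpace (metricKernel X) b → EReal}
    (hν : IsMeasure ν) {v : X → ℝ} (hr : Represents ν fun x => (v x : EReal)) (x : X) {δ : ℝ}
    (hδ : 0 < δ) :
    ∃ (η : minimalMartinSpace (metricKernel X) b) (g : X → ℝ) (t : ℝ),
      η.1 = (fun z => (g z : EReal)) ∧ ν η = t ∧ g b = 0 ∧ (∀ z w, g z ≤ g w + dist z w) ∧
      (∀ z, g z + t ≤ v z) ∧ v x - δ < g x + t := by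
  have hlt : ((v x - δ : ℝ) : EReal) < ⨆ ξ : minimalMartinSpace (metricKernel X) b,
      ξ.1 x + ν ξ := by
    exact (EReal.coe_lt_coe (sub_lt_self (v x) hδ)).trans_eq (hr x)
  obtain ⟨η, hη⟩ := lt_iSup_iff.1 hlt
  obtain ⟨g, hg, hgb, hgl⟩ := exists_real_of_mem_martinSpace η.2.1
  have hbot : ν η ≠ ⊥ := fun h => by
    rw [h, EReal.add_bot] at hη
    exact not_lt_bot hη
  obtain ⟨t, ht⟩ : ∃ t : ℝ, ν η = t := ⟨_, (EReal.coe_toReal (hν.1 η) hbot).symm⟩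
  refine ⟨η, g, t, funext hg, ht, hgb, hgl, fun z => ?_, ?_⟩
  · have : η.1 z + ν η ≤ (v z : EReal) :=
      (le_iSup (fun ξ : minimalMartinSpace (metricKernel X) b => ξ.1 z + ν ξ) η).trans_eq
        (hr z).symm
    rw [hg, ht] at this
    exact_mod_cast this
  · rw [hg, ht] at hη
    exact_mod_cast hη

/-- Up to `ε`, the value at `x₀` of a nonexpansive function `v` is accounted for by a point of the
minimal Martin space on which every measure representing `v` has a prescribed mass. -/
theorem exists_point_charged_by_representing_measures [TopologicalSpace.SeparableSpace X] (b : X)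
    {v : X → ℝ} (hv : ∀ x y, v x ≤ v y + dist x y) (x₀ : X) {ε : ℝ} (hε : 0 < ε) :
    ∃ (ξ : minimalMartinSpace (metricKernel X) b) (c : ℝ),
      ((v x₀ - ε : ℝ) : EReal) ≤ ξ.1 x₀ + c ∧ (∀ x, ξ.1 x + c ≤ (v x : EReal)) ∧
      ∀ ν : minimalMartinSpace (metricKernel X) b → EReal, IsMeasure ν →
        Represents ν (fun x => (v x : EReal)) → (c : EReal) ≤ ν ξ := by
  classical
  have : Nonempty X := ⟨b⟩
  set q := TopologicalSpace.denseSeq X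
  have hq : DenseRange q := TopologicalSpace.denseRange_denseSeq X
  -- The step errors `e k - e (k + 1)` telescope: the loss from time `k` on is at most `e k`, and
  -- `ε` in all.
  set e : ℕ → ℝ := fun k => ε * (1 / 2) ^ k with he_def
  have he : Tendsto e atTop (𝓝 0) := by
    rw [← mul_zero ε]
    exact (tendsto_pow_atTop_nhds_zero_of_lt_one (by norm_num) (by norm_num)).const_mul ε
  have hepos (k : ℕ) : 0 < e k - e (k + 1) := by
    have : e k - e (k + 1) = ε * (1 / 2) ^ (k + 1) := by simp only [he_def]; ring
    rw [this]; positivity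
  have he' : Tendsto (fun k => e k - e (k + 1)) atTop (𝓝 0) := by
    simpa using he.sub (he.comp (tendsto_add_atTop_nat 1))
  obtain ⟨x, hx0, hx⟩ := exists_maximizing_almostGeodesic b q hv x₀ hepos
  have hlim (z : X) := exists_tendsto_of_almost_monotone (a := fun k => v (x k) - dist z (x k)) he
    (fun k => by
      have := dist_triangle z (x k) (x (k + 1))
      linarith [(hx k).1])
    (B := v z) (fun k => by
      have := hv (x k) z
      rw [dist_comm] at this
      linarith)
  choose F hF hFe using hlim
  have hFv (z : X) : F z ≤ v z := le_of_tendsto' (hF z) fun k => by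
    have := hv (x k) z
    rw [dist_comm] at this
    linarith
  have hFl (z w : X) : F z ≤ F w + dist z w :=
    le_of_tendsto_of_tendsto' (hF z) ((hF w).add_const _) fun k =>
      sub_dist_le_sub_dist_add _ _ _ _
  have hK (z : X) : Tendsto (fun k => dist b (x k) - dist z (x k)) atTop (𝓝 (F z - F b)) := by
    refine ((hF z).sub (hF b)).congr fun k => ?_
    ring
  have hK' : Tendsto (fun k => martinKernel (metricKernel X) b (x k)) atTop
      (𝓝 fun z => ((F z - F b : ℝ) : EReal)) := by
    rw [tendsto_pi_nhds]
    intro z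
    simp only [martinKernel_metricKernel, EReal.tendsto_coe]
    exact hK z
  have hmem : (fun z => ((F z - F b : ℝ) : EReal)) ∈ martinSpace (metricKernel X) b :=
    mem_closure_of_tendsto hK' (Eventually.of_forall fun k => ⟨x k, rfl⟩)
  have hmin : (fun z => ((F z - F b : ℝ) : EReal)) ∈ minimalMartinSpace (metricKernel X) b := by
    refine (mem_minimalMartinSpace_iff hmem).2 fun δ hδ => ?_
    refine Tendsto.frequently (tendsto_comap_iff.2 hK') (Eventually.frequently ?_)
    -- `F (x k) ≥ v (x k) - e k`, so this sequence bounds `F (x k) - F b - d(b, x k)` from below.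
    have h : Tendsto (fun k => (v (x k) - dist b (x k)) - F b - e k) atTop (𝓝 0) := by
      simpa using ((hF b).sub_const (F b)).sub he
    filter_upwards [h.eventually (lt_mem_nhds (neg_lt_zero.2 hδ))] with k hk
    have := hFe (x k) k
    rw [dist_self] at this
    linarith
  refine ⟨⟨_, hmin⟩, F b, ?_, fun z => ?_, fun ν hν hr => ?_⟩
  · have h1 := hFe x₀ 0
    have h2 : e 0 = ε := by simp [he_def]
    rw [hx0, dist_self, h2] at h1
    change _ ≤ ((F x₀ - F b : ℝ) : EReal) + _
    exact_mod_cast (by linarith : v x₀ - ε ≤ F x₀ - F b + F b)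
  · have := hFv z
    change ((F z - F b : ℝ) : EReal) + _ ≤ _
    exact_mod_cast (by linarith : F z - F b + F b ≤ v z)
  -- A third of the step error, so that the loss `3 * δ` keeps `y k` admissible. The finite sets of
  -- test points exhaust the dense sequence.
  have hδ (k : ℕ) : 0 < (e k - e (k + 1)) / 3 := div_pos (hepos k) (by norm_num)
  choose η g t hη ht hgb hgl hle hgt using fun k => hr.exists_real hν (x k) (hδ k)
  choose y hy hyq using fun k => exists_dist_close (by rw [← hη k]; exact (η k).2) (hle k) (hgt k)
    (hδ k) ((Finset.range k).image q)
  have hy' (k : ℕ) : v (x k) - (e k - e (k + 1)) ≤ v (y k) - dist (x k) (y k) := by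
    linarith [hy k]
  have hlimy (z : X) : Tendsto (fun k => v (y k) - dist z (y k)) atTop (𝓝 (F z)) :=
    tendsto_of_nonexpansive_of_dense hq (f := fun k z => v (y k) - dist z (y k))
      (fun k z w => sub_dist_le_sub_dist_add _ _ _ _) hFl
      (tendsto_of_maximizing hv he (fun k => (hx k).1) (fun k => (hx k).2) hy' hF) z
  have hgq (n : ℕ) : Tendsto (fun k => g k (q n)) atTop (𝓝 (F (q n) - F b)) := by
    have h1 : Tendsto (fun k => dist b (y k) - dist (q n) (y k)) atTop
        (𝓝 (F (q n) - F b)) := by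
      refine ((hlimy (q n)).sub (hlimy b)).congr fun k => ?_
      ring
    have h2 : Tendsto (fun k => dist b (y k) - dist (q n) (y k) - g k (q n)) atTop (𝓝 0) := by
      refine squeeze_zero_norm' ?_ (by simpa using he'.div_const 3)
      filter_upwards [eventually_gt_atTop n] with k hk
      exact (hyq k (q n) (Finset.mem_image_of_mem _ (by simpa using hk))).le
    simpa using h1.sub h2
  have hglim (z : X) : Tendsto (fun k => g k z) atTop (𝓝 (F z - F b)) :=
    tendsto_of_nonexpansive_of_dense hq (g := fun z => F z - F b) hgl
      (fun z w => by linarith [hFl z w]) hgq z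
  have hηlim : Tendsto η atTop (𝓝 ⟨_, hmin⟩) := by
    rw [tendsto_subtype_rng, tendsto_pi_nhds]
    intro z
    simp only [hη, EReal.tendsto_coe]
    exact hglim z
  -- `ν (η k) = t k` exceeds `v (x k) - g k (x k)` up to a vanishing error, hence `v (x k) - d(b, x
  -- k)`, which tends to `F b`. Semicontinuity at the limit of `η` forbids `ν ξ < F b`.
  by_contra hlt
  obtain ⟨r, hνr, hrF⟩ := EReal.lt_iff_exists_real_btwn.1 (not_le.1 hlt)
  have hlow : Tendsto (fun k => v (x k) - dist b (x k) - (e k - e (k + 1)) / 3) atTop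
      (𝓝 (F b)) := by
    simpa using (hF b).sub (he'.div_const 3)
  obtain ⟨k, hk1, hk2⟩ := ((hηlim.eventually (hν.2 _ _ hνr)).and
    (hlow.eventually (lt_mem_nhds (EReal.coe_lt_coe_iff.1 hrF)))).exists
  rw [ht k, EReal.coe_lt_coe_iff] at hk1
  have h1 := hgl k (x k) b
  rw [hgb k, dist_comm] at h1
  linarith [hgt k]

end Representation

end MaxPlus

/-! ### The least representing measure -/

open MaxPlus in
theorem mainTheorem3 {X : Type*} [MetricSpace X] [TopologicalSpace.SeparableSpace X] (b : X)
    (u : X → EReal) (hu : MaxPlus.IsHarmonic (MaxPlus.metricKernel X) u) :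
    ∃ μ : MaxPlus.minimalMartinSpace (MaxPlus.metricKernel X) b → EReal,
      MaxPlus.IsMeasure μ ∧ (∃ C : ℝ, ∀ ξ, μ ξ ≤ (C : EReal)) ∧ MaxPlus.Represents μ u ∧
      ∀ ν : MaxPlus.minimalMartinSpace (MaxPlus.metricKernel X) b → EReal,
        MaxPlus.IsMeasure ν → MaxPlus.Represents ν u → ∀ ξ, μ ξ ≤ ν ξ := by
  obtain hbot | ⟨v, huv, hv⟩ := hu.eq_bot_or_real
  · exact ⟨fun _ => ⊥, ⟨by simp, upperSemicontinuous_const⟩, ⟨0, by simp⟩,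
      fun x => by simp [hbot], by simp⟩
  obtain rfl : u = fun x => (v x : EReal) := funext huv
  let D := minimalMartinSpace (metricKernel X) b
  let ρ : D → EReal := fun ξ => ⨅ x, ((v x : EReal) - ξ.1 x)
  have hρ : UpperSemicontinuous ρ := upperSemicontinuous_iInf fun x => by
    refine Continuous.upperSemicontinuous ?_
    rw [continuous_iff_continuousAt]
    intro ξ
    simp only [sub_eq_add_neg]
    refine (EReal.continuousAt_add (Or.inl (EReal.coe_ne_top _))
      (Or.inl (EReal.coe_ne_bot _))).comp
      (f := fun ξ : D => ((v x : EReal), -ξ.1 x)) ?_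
    exact continuousAt_const.prodMk
      (continuous_neg.comp ((continuous_apply x).comp continuous_subtype_val)).continuousAt
  let N := {ν : D → EReal // IsMeasure ν ∧ Represents ν fun x => (v x : EReal)}
  -- The meet with `ρ` gives `ξ + μ ξ ≤ v` and the upper bound `v b` without knowing that `N` is
  -- nonempty; existence of a representing measure is thus part of the conclusion.
  let μ : D → EReal := fun ξ => ρ ξ ⊓ ⨅ ν : N, ν.1 ξ
  have hμ : UpperSemicontinuous μ :=
    hρ.inf (upperSemicontinuous_iInf fun ν : N => ν.2.1.2)
  have hreal (ξ : D) := exists_real_of_mem_martinSpace ξ.2.1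
  have hC (ξ : D) : μ ξ ≤ (v b : EReal) := by
    obtain ⟨g, hg, hgb, -⟩ := hreal ξ
    refine inf_le_left.trans ((iInf_le _ b).trans ?_)
    rw [hg, hgb]
    simp
  refine ⟨μ, ⟨fun ξ h => ?_, hμ⟩, ⟨v b, hC⟩, fun x => ?_, fun ν hν hr ξ =>
    inf_le_right.trans (iInf_le (fun ν : N => ν.1 ξ) ⟨ν, hν, hr⟩)⟩
  · have := hC ξ
    rw [h, top_le_iff] at this
    exact EReal.coe_ne_top _ this
  · apply le_antisymm
    · refine EReal.ge_of_forall_gt_iff_ge.1 fun r hr => ?_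
      have hr' : r < v x := EReal.coe_lt_coe_iff.1 hr
      obtain ⟨ξ, c, h1, h2, h3⟩ :=
        exists_point_charged_by_representing_measures b hv x (sub_pos.2 hr')
      rw [sub_sub_cancel] at h1
      refine h1.trans (le_trans (add_le_add le_rfl ?_)
        (le_iSup (fun ξ : D => ξ.1 x + μ ξ) ξ))
      refine le_inf (le_iInf fun z => ?_) (le_iInf fun ν => h3 ν.1 ν.2.1 ν.2.2)
      obtain ⟨g, hg, -, -⟩ := hreal ξ
      have := h2 z
      rw [hg] at this ⊢
      have h4 : g z + c ≤ v z := by exact_mod_cast this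
      exact_mod_cast (by linarith : c ≤ v z - g z)
    · refine iSup_le fun ξ => ?_
      obtain ⟨g, hg, -, -⟩ := hreal ξ
      calc ξ.1 x + μ ξ ≤ ξ.1 x + ((v x : EReal) - ξ.1 x) :=
            add_le_add le_rfl (inf_le_left.trans (iInf_le _ x))
        _ = (v x : EReal) := by
          rw [hg, ← EReal.coe_sub, ← EReal.coe_add, add_sub_cancel]
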